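/- Let $\overline\rho>0$, $f\in C^1[0,\overline\rho]$ with $f(0)=0$, $h=f'$, $c\in\mathbb R$. For a source term $g\in C[0,\overline\rho]$ consider $$\rho_t+f(\rho)_x=(D(\rho)\rho_x)_x+g(\rho).\qquad (E_g)$$ A traveling-wave profile of $(E_g)$ with speed $c$ on an open interval $I$ is a continuous function $\varphi:I\to[0,\overline\rho]$, differentiable a.e., with $D(\varphi)\varphi'\in L^1_{\rm loc}(I)$ and $$\int_I\{(D(\varphi)\varphi'-f(\varphi)+c\varphi)\psi'-g(\varphi)\psi\}\,d\xi=0\quad\text{for all }\psi\in C_0^\infty(I).$$ It is classical on an open set $U\subseteq I$ if it is differentiable in $U$, $D(\varphi)\varphi'$ is absolutely continuous on the compact intervals contained in $U$, and $(D(\varphi)\varphi')'+(c-h(\varphi))\varphi'+g(\varphi)=0$ a.e. in $U$. All profiles below are assumed to be classical or sharp, i.e. classical on $I\setminus S$ for some finite (possibly empty) set $S\subseteq I$ at each point of which $\varphi$ is not differentiable and takes a value where $g$ vanishes. A wavefront profile connecting $\overline\rho$ with $0$ is a profile on $I=\mathbb R$ with $\varphi(-\infty)=\overline\rho$, $\varphi(+\infty)=0$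 and $g(\overline\rho)=g(0)=0$. A semi-wavefront profile from $\overline\rho$ is a monotone (in the weak sense), non-constant profile on some half-line $I=(-\infty,\varpi)$, $\varpi\in\mathbb R$, with $\varphi(-\infty)=\overline\rho$ and $g(\overline\rho)=0$. Let $g_0,g_1,g_2,\dots\in C[0,\overline\rho]$ be such that - $g_0>0$ in $(0,\overline\rho)$, $g_0(0)=g_0(\overline\rho)=0$ and $\limsup_{\rho\to0^+}D(\rho)g_0(\rho)/\rho<+\infty$; - for $n\ge1$, $g_n>0$ in $[0,\overline\rho)$ and $g_n(\overline\rho)=0$; - $(g_n)_{n\ge1}$ is decreasing in $n$ (in the weak sense) on $[0,\overline\rho]$, and $g_n\to g_0$ uniformly on $[0,\overline\rho]$. Assume that either $D\in C^1[0,\overline\rho]$ and $D>0$ in $(0,\overline\rho)$; or $D\in C[0,\overline\rho]\cap C^1[0,\overline\rho)$, $D>0$ in $(0,\overline\rho)$, $D(\overline\rho)=0$, the derivative of $D$ at $\overline\rho$ is $-\infty$, and for every $n\ge0$ the limit of $D(\rho)g_n(\rho)/(\rho-\overline\rho)$ as $\rho\to\overline\rho^-$ exists in $(-\infty,0]$.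 Let $\varphi_0$ be a wavefront profile of $(E_{g_0})$ connecting $\overline\rho$ with $0$ and, for $n\ge1$, let $\varphi_n$ be a semi-wavefront profile of $(E_{g_n})$ from $\overline\rho$, defined on $(-\infty,\varpi_n)$ with $\varpi_n>0$; all of them have the same speed $c$ and satisfy $\varphi_n(0)=\overline\rho/2$ for $n\ge0$. (1) If $n\ge1$ and $g_0<g_n$ on $(0,\overline\rho)$, then for every $\xi<0$ we have $\varphi_0(\xi)<\varphi_n(\xi)$ if $\varphi_0(\xi)<\overline\rho$, and $\varphi_n(\xi)=\overline\rho$ if $\varphi_0(\xi)=\overline\rho$; moreover $\varphi_0(\xi)>\varphi_n(\xi)$ for every $\xi\in(0,\varpi_n)$. (2) If $(g_n)_{n\ge1}$ is strictly decreasing in $n$ on $(0,\overline\rho)$, then $(\varphi_n)_{n\ge1}$ is decreasing in $n$ on $(-\infty,0)$ and increasing in $n$ on every interval $[0,a]$ with $a<\varpi_n$ for all $n\ge1$. More precisely, let $1\le m<n$. If $\xi<0$, then $\varphi_n(\xi)\le\varphi_m(\xi)$, with strict inequality if $\varphi_n(\xi)<\overline\rho$. If $0\le\xi\le a$, then $\varphi_m(\xi)\le\varphi_n(\xi)$,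 with strict inequality if $\xi>0$. -/

import Mathlib

open Set Filter Topology MeasureTheory
open scoped ContDiff

/-- The flux term `ξ ↦ D(φ(ξ)) φ'(ξ)`. It is only used on open sets, so that `deriv` at the points
of the set depends only on the values of `φ` there. -/
noncomputable def diffusionFlux (D φ : ℝ → ℝ) : ℝ → ℝ := fun ξ => D (φ ξ) * deriv φ ξ

/-- `φ : I → [0, R]` is the profile of a traveling-wave solution `ρ(x,t) = φ(x - c t)` of
`ρ_t + f(ρ)_x = (D(ρ) ρ_x)_x + g(ρ)` on the open interval `I`, with speed `c`:
`φ` is continuous, differentiable a.e., `D(φ) φ'` is locally integrable, and the equation holds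
in the weak sense against all test functions in `C₀^∞(I)`. -/
structure IsTravelingWaveProfile (R : ℝ) (D f g : ℝ → ℝ) (c : ℝ) (I : Set ℝ) (φ : ℝ → ℝ) :
    Prop where
  isOpen : IsOpen I
  ordConnected : I.OrdConnected
  mapsTo : MapsTo φ I (Icc 0 R)
  continuousOn : ContinuousOn φ I
  ae_differentiable : ∀ᵐ ξ ∂(volume.restrict I), DifferentiableAt ℝ φ ξ
  locallyIntegrableOn : LocallyIntegrableOn (diffusionFlux D φ) I volume
  weak : ∀ ψ : ℝ → ℝ, ContDiff ℝ ∞ ψ → HasCompactSupport ψ → tsupport ψ ⊆ I →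
    ∫ ξ in I, ((diffusionFlux D φ ξ - f (φ ξ) + c * φ ξ) * deriv ψ ξ - g (φ ξ) * ψ ξ) = 0

/-- `φ` is classical on the open set `U`: it is differentiable in `U`, `D(φ) φ'` is absolutely
continuous (on compact intervals contained in `U`), and
`(D(φ) φ')' + (c - h(φ)) φ' + g(φ) = 0` a.e. in `U`, where `h = f'` on `[0, R]`. -/
structure IsClassicalOn (R : ℝ) (D f g : ℝ → ℝ) (c : ℝ) (U : Set ℝ) (φ : ℝ → ℝ) : Prop where
  differentiableAt : ∀ ξ ∈ U, DifferentiableAt ℝ φ ξ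
  absolutelyContinuous : ∀ a b : ℝ, a ≤ b → Icc a b ⊆ U →
    AbsolutelyContinuousOnInterval (diffusionFlux D φ) a b
  ode : ∀ᵐ ξ ∂(volume.restrict U),
    deriv (diffusionFlux D φ) ξ + (c - derivWithin f (Icc 0 R) (φ ξ)) * deriv φ ξ + g (φ ξ) = 0

/-- `φ` is classical or sharp in `I`: it is classical off a finite set `S` of points, at which `φ`
is not differentiable and takes a value where `g` vanishes. `S = ∅` is the classical case,
`S = {ξ₀}` the case of a profile which is sharp at `φ ξ₀`; a wavefront profile may also be sharp at
both of its end states, and then `S` has two points. -/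
def IsClassicalOrSharp (R : ℝ) (D f g : ℝ → ℝ) (c : ℝ) (I : Set ℝ) (φ : ℝ → ℝ) : Prop :=
  ∃ S : Set ℝ, S.Finite ∧ S ⊆ I ∧ (∀ ξ ∈ S, g (φ ξ) = 0 ∧ ¬ DifferentiableAt ℝ φ ξ) ∧
    IsClassicalOn R D f g c (I \ S) φ

/-- `φ` is the profile of a (classical or sharp) wavefront solution connecting `l` (at `-∞`) with
`r` (at `+∞`). -/
structure IsWavefrontProfile (R : ℝ) (D f g : ℝ → ℝ) (c l r : ℝ) (φ : ℝ → ℝ) : Prop where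
  travelingWave : IsTravelingWaveProfile R D f g c univ φ
  classicalOrSharp : IsClassicalOrSharp R D f g c univ φ
  zero_left : g l = 0
  zero_right : g r = 0
  tendsto_left : Tendsto φ atBot (𝓝 l)
  tendsto_right : Tendsto φ atTop (𝓝 r)

/-- `φ`, defined in `(-∞, w)`, is the profile of a (classical or sharp) semi-wavefront solution
from `l`. Only the values of `φ` in `(-∞, w)` matter. -/
structure IsSemiWavefrontProfileFrom (R : ℝ) (D f g : ℝ → ℝ) (c l w : ℝ) (φ : ℝ → ℝ) :
    Prop where
  travelingWave : IsTravelingWaveProfile R D f g c (Iio w) φ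
  classicalOrSharp : IsClassicalOrSharp R D f g c (Iio w) φ
  mem : l ∈ Icc 0 R
  zero : g l = 0
  monotonic : MonotoneOn φ (Iio w) ∨ AntitoneOn φ (Iio w)
  nonconstant : ¬ ∃ k : ℝ, ∀ ξ ∈ Iio w, φ ξ = k
  tendsto_left : Tendsto φ atBot (𝓝 l)

/-- `D ∈ C¹[0, R]` and `D > 0` in `(0, R)`. -/
structure DiffusivityHat (R : ℝ) (D : ℝ → ℝ) : Prop where
  contDiffOn : ContDiffOn ℝ 1 D (Icc 0 R)
  pos : ∀ ρ ∈ Ioo 0 R, 0 < D ρ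

/-- `D ∈ C[0, R] ∩ C¹[0, R)`, `D(R) = 0`, `D > 0` in `(0, R)`, the derivative of `D` at `R`
is `-∞`, and `D(ρ) g(ρ) / (ρ - R)` has a limit in `(-∞, 0]` as `ρ → R⁻`. -/
structure DiffusivityTilde (R : ℝ) (D g : ℝ → ℝ) : Prop where
  continuousOn : ContinuousOn D (Icc 0 R)
  contDiffOn : ContDiffOn ℝ 1 D (Ico 0 R)
  zero : D R = 0
  pos : ∀ ρ ∈ Ioo 0 R, 0 < D ρ
  deriv_right : Tendsto (fun ρ => (D ρ - D R) / (ρ - R)) (𝓝[<] R) atBot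
  limit : ∃ l : ℝ, l ≤ 0 ∧ Tendsto (fun ρ => D ρ * g ρ / (ρ - R)) (𝓝[<] R) (𝓝 l)

/-- `g ∈ C[0, R]`, `g > 0` in `[0, R)` and `g(R) = 0`. -/
structure SourcePositive (R : ℝ) (g : ℝ → ℝ) : Prop where
  continuousOn : ContinuousOn g (Icc 0 R)
  pos : ∀ ρ ∈ Ico 0 R, 0 < g ρ
  zero : g R = 0

/-- `g ∈ C[0, R]`, `g > 0` in `(0, R)`, `g(0) = g(R) = 0` and
`limsup_{ρ → 0⁺} D(ρ) g(ρ) / ρ < +∞` (the limsup taken in the extended reals). -/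
structure SourceMonostable (R : ℝ) (D g : ℝ → ℝ) : Prop where
  continuousOn : ContinuousOn g (Icc 0 R)
  pos : ∀ ρ ∈ Ioo 0 R, 0 < g ρ
  zero_left : g 0 = 0
  zero_right : g R = 0
  limsup_lt : limsup (fun ρ : ℝ => ((D ρ * g ρ / ρ : ℝ) : EReal)) (𝓝[>] 0) < ⊤

/-!
The Kirchhoff transform of a profile is `C¹`, and the weak equation gives it a continuous flux `p`
for which `p - f(φ) + c φ` has derivative `-g(φ)`. Since this quantity is nonincreasing, a wavefront
is monotone, and where `0 < φ < R` the flux is negative, so that `φ` has an inverse `T` there. As a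
function of the density, `z = p ∘ T` solves `z' = f' - c - D g / z` and tends to `0` at `R`. A
larger source thus gives a smaller `z`: otherwise the difference of the two solutions, once
nonnegative, would stay so and increase, and could not vanish at `R`. As `T' = D / z` and
`T(R / 2) = 0` for all profiles, the difference of two inverses is strictly monotone and changes
sign at `R / 2`, and this orders the profiles on the two sides of `ξ = 0`.
-/

theorem exists_Icc_superset_of_isCompact {α : Type*} [ConditionallyCompleteLinearOrder α]
    [TopologicalSpace α] [OrderTopology α] {I K : Set α} (hI : I.OrdConnected) (hK : IsCompact K)
    (hne : K.Nonempty) (hKI : K ⊆ I) : ∃ a b, K ⊆ Icc a b ∧ Icc a b ⊆ I :=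
  ⟨sInf K, sSup K, fun _ hx => ⟨(hK.isLeast_sInf hne).2 hx, (hK.isGreatest_sSup hne).2 hx⟩,
    hI.out (hKI (hK.sInf_mem hne)) (hKI (hK.sSup_mem hne))⟩

theorem integrable_mul_of_tsupport_subset {I : Set ℝ} {u θ : ℝ → ℝ}
    (hu : LocallyIntegrableOn u I) (hθ : Continuous θ) (hθc : HasCompactSupport θ)
    (hθI : tsupport θ ⊆ I) : Integrable fun x => u x * θ x :=
  (integrableOn_iff_integrable_of_support_subset fun _ hx =>
    subset_tsupport θ (right_ne_zero_of_mul hx)).1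
    ((hu.integrableOn_compact_subset hθI hθc).mul_continuousOn hθ.continuousOn hθc)

theorem exists_contDiff_deriv_eq {a b : ℝ} {θ : ℝ → ℝ} (hθ : ContDiff ℝ ∞ θ)
    (hθs : tsupport θ ⊆ Icc a b) (hθ0 : ∫ x, θ x = 0) :
    ∃ ψ : ℝ → ℝ, ContDiff ℝ ∞ ψ ∧ HasCompactSupport ψ ∧ tsupport ψ ⊆ Icc a b ∧ deriv ψ = θ := by
  have hθz : ∀ x ∉ Icc a b, θ x = 0 := fun x hx =>
    image_eq_zero_of_notMem_tsupport fun h => hx (hθs h)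
  let ψ : ℝ → ℝ := fun x => ∫ t in (a - 1)..x, θ t
  have hψ : ∀ x, HasDerivAt ψ (θ x) x := fun x =>
    (hθ.continuous.integral_hasStrictDerivAt (a - 1) x).hasDerivAt
  have hψd : deriv ψ = θ := funext fun x => (hψ x).deriv
  have hψs : tsupport ψ ⊆ Icc a b := by
    refine closure_minimal (fun x hx => by_contra fun hxab => hx ?_) isClosed_Icc
    rcases lt_or_ge x a with hxa | hax
    · refine intervalIntegral.integral_zero_ae (ae_of_all _ fun t ht => hθz t fun ht' => ?_)
      exact absurd (ht.2.trans_lt (max_lt (by linarith) hxa)) ht'.1.not_gt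
    · have hbx : b < x := not_le.1 fun hxb => hxab ⟨hax, hxb⟩
      refine (intervalIntegral.integral_eq_integral_of_support_subset fun t ht => ?_).trans hθ0
      have htab := hθs (subset_tsupport θ ht)
      exact ⟨by linarith [htab.1], htab.2.trans hbx.le⟩
  exact ⟨ψ, contDiff_infty_iff_deriv.2 ⟨fun x => (hψ x).differentiableAt, hψd ▸ hθ⟩,
    isCompact_Icc.of_isClosed_subset (isClosed_tsupport ψ) hψs, hψs, hψd⟩

theorem exists_contDiff_integral_eq_one {I : Set ℝ} (hI : IsOpen I) (hne : I.Nonempty) :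
    ∃ η : ℝ → ℝ, ContDiff ℝ ∞ η ∧ HasCompactSupport η ∧ tsupport η ⊆ I ∧ ∫ x, η x = 1 := by
  obtain ⟨x, hx⟩ := hne
  obtain ⟨ε, hε, hεI⟩ := Metric.nhds_basis_closedBall.mem_iff.1 (hI.mem_nhds hx)
  let B : ContDiffBump x := ⟨ε / 2, ε, half_pos hε, half_lt_self hε⟩
  exact ⟨B.normed volume, B.contDiff_normed, B.hasCompactSupport_normed,
    (B.tsupport_normed_eq (μ := volume)).trans_subset hεI, B.integral_normed⟩

/-- The lemma of du Bois-Reymond. -/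
theorem exists_ae_eq_const_of_forall_integral_mul_deriv_eq_zero {I : Set ℝ} {u : ℝ → ℝ}
    (hI : IsOpen I) (hI' : I.OrdConnected) (hu : LocallyIntegrableOn u I)
    (h : ∀ ψ : ℝ → ℝ, ContDiff ℝ ∞ ψ → HasCompactSupport ψ → tsupport ψ ⊆ I →
      ∫ x, u x * deriv ψ x = 0) :
    ∃ C : ℝ, ∀ᵐ x, x ∈ I → u x = C := by
  rcases I.eq_empty_or_nonempty with rfl | hne
  · exact ⟨0, by simp⟩
  obtain ⟨η, hη, hηc, hηI, hη1⟩ := exists_contDiff_integral_eq_one hI hne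
  have hηint : Integrable η := hη.continuous.integrable_of_hasCompactSupport hηc
  set C := ∫ x, u x * η x with hC
  suffices hzero : ∀ᵐ x, x ∈ I → u x - C = 0 from
    ⟨C, hzero.mono fun x hx hxI => sub_eq_zero.1 (hx hxI)⟩
  refine hI.ae_eq_zero_of_integral_contDiff_smul_eq_zero
    (hu.sub ((locallyIntegrable_const C).locallyIntegrableOn I)) fun θ hθ hθc hθI => ?_
  have hθint : Integrable θ := hθ.continuous.integrable_of_hasCompactSupport hθc
  have huθ := integrable_mul_of_tsupport_subset hu hθ.continuous hθc hθI
  have huη := integrable_mul_of_tsupport_subset hu hη.continuous hηc hηI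
  have hηne : (tsupport η).Nonempty :=
    nonempty_iff_ne_empty.2 fun hη0 => by simp [tsupport_eq_empty_iff.1 hη0] at hη1
  set m := ∫ x, θ x with hm
  obtain ⟨a, b, hKab, habI⟩ := exists_Icc_superset_of_isCompact hI'
    (hθc.isCompact.union hηc.isCompact) hηne.inr (union_subset hθI hηI)
  -- `θ - m η` has mean zero, hence is the derivative of a test function.
  obtain ⟨ψ, hψ, hψc, hψs, hψd⟩ := exists_contDiff_deriv_eq (hθ.sub (contDiff_const.mul hη))
    ((tsupport_sub _ _).trans ((union_subset_union_right _ (tsupport_mul_subset_right)).trans hKab))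
    (by rw [integral_sub hθint (hηint.const_mul m), integral_const_mul, hη1, mul_one, sub_self])
  calc ∫ x, θ x • (u x - C) = (∫ x, u x * θ x) - m * C := by
        rw [mul_comm m, hm, ← integral_const_mul, ← integral_sub huθ (hθint.const_mul C)]
        exact integral_congr_ae (ae_of_all _ fun x => by simp only [smul_eq_mul]; ring)
    _ = ∫ x, u x * deriv ψ x := by
        rw [hψd, hC, ← integral_const_mul, ← integral_sub huθ (huη.const_mul m)]
        exact integral_congr_ae (ae_of_all _ fun x => by simp only []; ring)
    _ = 0 := h ψ hψ hψc (hψs.trans habI)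

theorem hasDerivAt_of_eventually_hasDerivAt_nhdsNE {f f' : ℝ → ℝ} {x : ℝ}
    (hf : ∀ᶠ y in 𝓝[≠] x, HasDerivAt f (f' y) y) (hfc : ContinuousAt f x)
    (hf'c : ContinuousAt f' x) : HasDerivAt f (f' x) x := by
  have hnear : ∀ {s : Set ℝ}, s ⊆ {x}ᶜ → ∀ᶠ y in 𝓝[s] x, HasDerivAt f (f' y) y :=
    fun hs => hf.filter_mono (nhdsWithin_mono x hs)
  have hdiff : ∀ {s : Set ℝ}, DifferentiableOn ℝ f ({y | HasDerivAt f (f' y) y} ∩ s) :=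
    fun y hy => hy.1.differentiableAt.differentiableWithinAt
  have hderiv : ∀ {s : Set ℝ}, s ⊆ {x}ᶜ → Tendsto (deriv f) (𝓝[s] x) (𝓝 (f' x)) := fun hs =>
    (hf'c.tendsto.mono_left nhdsWithin_le_nhds).congr' ((hnear hs).mono fun y hy => hy.deriv.symm)
  have hl : Iio x ⊆ {x}ᶜ := fun y hy => ne_of_lt hy
  have hr : Ioi x ⊆ {x}ᶜ := fun y hy => ne_of_gt hy
  simpa using (hasDerivWithinAt_Iic_of_tendsto_deriv hdiff hfc.continuousWithinAt
    (inter_mem (hnear hl) self_mem_nhdsWithin) (hderiv hl)).union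
    (hasDerivWithinAt_Ici_of_tendsto_deriv hdiff hfc.continuousWithinAt
    (inter_mem (hnear hr) self_mem_nhdsWithin) (hderiv hr))

theorem mapClusterPt_zero_of_hasDerivAt {F : Filter ℝ} [F.NeBot] [TendstoIxxClass Icc F F]
    {u u' : ℝ → ℝ} {l : ℝ} (hF : Tendsto (· + 1) F F) (hu : ∀ᶠ x in F, HasDerivAt u (u' x) x)
    (hl : Tendsto u F (𝓝 l)) : MapClusterPt 0 F u' := by
  have hdiff : Tendsto (fun x => u (x + 1) - u x) F (𝓝 0) := by
    simpa using (hl.comp hF).sub hl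
  refine mapClusterPt_iff_frequently.2 fun s hs => frequently_iff.2 fun {t} ht => ?_
  have hIcc : ∀ᶠ x in F, Icc x (x + 1) ⊆ t ∩ {y | HasDerivAt u (u' y) y} :=
    (tendsto_id.Icc hF).eventually (eventually_smallSets.2 ⟨_, inter_mem ht hu, fun _ h => h⟩)
  obtain ⟨x, hx, hxs⟩ := (hIcc.and (hdiff.eventually_mem hs)).exists
  obtain ⟨y, hy, hy'⟩ := exists_hasDerivAt_eq_slope u u' (lt_add_one x)
    (fun y hy => (hx hy).2.continuousAt.continuousWithinAt)
    fun y hy => (hx (Ioo_subset_Icc_self hy)).2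
  rw [add_sub_cancel_left, div_one] at hy'
  exact ⟨y, (hx (Ioo_subset_Icc_self hy)).1, hy' ▸ hxs⟩

theorem continuousAt_of_antitoneOn_of_image_mem_nhds {α β : Type*} [LinearOrder α]
    [TopologicalSpace α] [OrderTopology α] [LinearOrder β] [TopologicalSpace β] [OrderTopology β]
    [DenselyOrdered β] {f : α → β} {s : Set α} {a : α} (hf : AntitoneOn f s) (hs : s ∈ 𝓝 a)
    (hfs : f '' s ∈ 𝓝 (f a)) : ContinuousAt f a :=
  continuousAt_of_monotoneOn_of_image_mem_nhds (β := βᵒᵈ) hf.dual_right hs hfs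

theorem hasDerivAt_invFunOn {φ : ℝ → ℝ} {φ' x : ℝ} {J : Set ℝ} (hJ : J ∈ 𝓝 x)
    (hφ : ContinuousOn φ J) (hanti : StrictAntiOn φ J) (hφ' : HasDerivAt φ φ' x) (h0 : φ' ≠ 0) :
    HasDerivAt (Function.invFunOn φ J) φ'⁻¹ (φ x) := by
  have hleft : LeftInvOn (Function.invFunOn φ J) φ J := hanti.injOn.leftInvOn_invFunOn
  have hx : Function.invFunOn φ J (φ x) = x := hleft (mem_of_mem_nhds hJ)
  have himage : φ '' J ∈ 𝓝 (φ x) := by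
    obtain ⟨ε, hε, hεJ⟩ := Metric.nhds_basis_closedBall.mem_iff.1 hJ
    rw [Real.closedBall_eq_Icc] at hεJ
    have hl : x - ε ∈ J := hεJ ⟨le_rfl, by linarith⟩
    have hr : x + ε ∈ J := hεJ ⟨by linarith, le_rfl⟩
    exact mem_of_superset (Icc_mem_nhds (hanti (mem_of_mem_nhds hJ) hr (by linarith))
      (hanti hl (mem_of_mem_nhds hJ) (by linarith)))
      ((intermediate_value_Icc' (by linarith) (hφ.mono hεJ)).trans (image_mono hεJ))
  have hinv : AntitoneOn (Function.invFunOn φ J) (φ '' J) := by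
    rintro _ ⟨y, hy, rfl⟩ _ ⟨z, hz, rfl⟩ hyz
    simpa only [hleft hy, hleft hz] using (hanti.le_iff_ge hy hz).1 hyz
  have hcont : ContinuousAt (Function.invFunOn φ J) (φ x) :=
    continuousAt_of_antitoneOn_of_image_mem_nhds hinv himage (by rwa [hleft.image_image, hx])
  refine HasDerivAt.of_local_left_inverse hcont (by rwa [hx]) h0 ?_
  filter_upwards [himage] with ρ hρ using Function.invFunOn_eq hρ

theorem lt_of_hasDerivAt_sub_div {a R : ℝ} {b q₁ q₂ z₁ z₂ : ℝ → ℝ} (haR : a < R)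
    (hz₁ : ∀ ρ ∈ Ico a R, HasDerivAt z₁ (b ρ - q₁ ρ / z₁ ρ) ρ)
    (hz₂ : ∀ ρ ∈ Ico a R, HasDerivAt z₂ (b ρ - q₂ ρ / z₂ ρ) ρ)
    (hneg₁ : ∀ ρ ∈ Ico a R, z₁ ρ < 0)
    (hq₂ : ∀ ρ ∈ Ico a R, 0 ≤ q₂ ρ) (hq : ∀ ρ ∈ Ico a R, q₂ ρ < q₁ ρ)
    (hlim₁ : Tendsto z₁ (𝓝[<] R) (𝓝 0)) (hlim₂ : Tendsto z₂ (𝓝[<] R) (𝓝 0)) :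
    z₁ a < z₂ a := by
  by_contra! hle
  set k : ℝ → ℝ := fun ρ => z₁ ρ - z₂ ρ
  set k' : ℝ → ℝ := fun ρ => (b ρ - q₁ ρ / z₁ ρ) - (b ρ - q₂ ρ / z₂ ρ) with hk'
  have hk : ∀ ρ ∈ Ico a R, HasDerivAt k (k' ρ) ρ := fun ρ hρ => (hz₁ ρ hρ).sub (hz₂ ρ hρ)
  have hkc : ContinuousOn k (Ico a R) := fun ρ hρ => (hk ρ hρ).continuousAt.continuousWithinAt
  have hpos : ∀ ρ ∈ Ico a R, 0 ≤ k ρ → 0 < k' ρ := by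
    intro ρ hρ hkρ
    have hquot : q₂ ρ / -z₂ ρ < q₁ ρ / -z₁ ρ :=
      div_lt_div₀ (hq ρ hρ) (neg_le_neg (sub_nonneg.1 hkρ)) ((hq₂ ρ hρ).trans (hq ρ hρ).le)
        (neg_pos.2 (hneg₁ ρ hρ))
    rw [div_neg, div_neg] at hquot
    simp only [hk']
    linarith
  have hnonneg : ∀ ρ ∈ Ico a R, 0 ≤ k ρ := by
    intro ρ hρ
    have hsub : ∀ x ∈ Icc a ρ, x ∈ Ico a R := fun x hx => ⟨hx.1, hx.2.trans_lt hρ.2⟩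
    exact image_le_of_deriv_right_lt_deriv_boundary' (f := fun _ => (0 : ℝ)) (f' := fun _ => 0)
      (B := k) continuousOn_const (fun x _ => hasDerivWithinAt_const ..) (sub_nonneg.2 hle)
      (hkc.mono hsub) (fun x hx => (hk x (hsub x (Ico_subset_Icc_self hx))).hasDerivWithinAt)
      (fun x hx h0 => hpos x (hsub x (Ico_subset_Icc_self hx)) h0.le) ⟨hρ.1, le_rfl⟩
  have hmono : StrictMonoOn k (Ico a R) :=
    strictMonoOn_of_deriv_pos (convex_Ico a R) hkc fun ρ hρ => by
      have hρ' := interior_subset hρ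
      exact (hk ρ hρ').deriv ▸ hpos ρ hρ' (hnonneg ρ hρ')
  obtain ⟨ρ₀, ha, hR⟩ := exists_between haR
  have hlim : Tendsto k (𝓝[<] R) (𝓝 0) := by simpa using hlim₁.sub hlim₂
  have h0 : k ρ₀ ≤ 0 := ge_of_tendsto hlim <| by
    filter_upwards [Ioo_mem_nhdsLT hR] with ρ hρ
    exact (hmono ⟨ha.le, hR⟩ ⟨ha.le.trans hρ.1.le, hρ.2⟩ hρ.1).le
  have h1 := hmono ⟨le_rfl, haR⟩ ⟨ha.le, hR⟩ ha
  linarith [hnonneg a ⟨le_rfl, haR⟩]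

theorem exists_hasDerivAt_of_continuousOn {I : Set ℝ} {u : ℝ → ℝ} (hI : IsOpen I)
    (hI' : I.OrdConnected) (hu : ContinuousOn u I) :
    ∃ U : ℝ → ℝ, ∀ x ∈ I, HasDerivAt U (u x) x := by
  rcases I.eq_empty_or_nonempty with rfl | ⟨a, ha⟩
  · exact ⟨0, by simp⟩
  · exact ⟨fun x => ∫ t in a..x, u t, fun x hx => intervalIntegral.integral_hasDerivAt_right
      (hu.mono (hI'.uIcc_subset ha hx)).intervalIntegrable
      (hu.stronglyMeasurableAtFilter hI x hx) (hu.continuousAt (hI.mem_nhds hx))⟩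

/-- The Kirchhoff transform `ρ ↦ ∫₀^ρ D` of the diffusivity. Along a profile `φ` it is
differentiable with derivative the flux `D(φ) φ'`, even at the sharp points, where `φ'` does not
exist. -/
noncomputable def kirchhoff (D : ℝ → ℝ) (ρ : ℝ) : ℝ := ∫ t in (0 : ℝ)..ρ, D t

/-- The total flux `p - f(φ) + c φ` in the moving frame, where `p` is the diffusive flux
`D(φ) φ'`. -/
def totalFlux (f : ℝ → ℝ) (c : ℝ) (φ p : ℝ → ℝ) (ξ : ℝ) : ℝ := p ξ - f (φ ξ) + c * φ ξ

/-- The regularity and sign conditions on the diffusivity `D`, the convection `f` and the source `g`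
under which profiles with values in `[0, R]` are studied. -/
structure AdmissibleCoefficients (R : ℝ) (D f g : ℝ → ℝ) : Prop where
  range_pos : 0 < R
  continuousOn_diffusivity : ContinuousOn D (Icc 0 R)
  diffusivity_pos : ∀ ρ ∈ Ioo 0 R, 0 < D ρ
  differentiableOn_convection : DifferentiableOn ℝ f (Icc 0 R)
  continuousOn_source : ContinuousOn g (Icc 0 R)
  source_pos : ∀ ρ ∈ Ioo 0 R, 0 < g ρ

namespace AdmissibleCoefficients

variable {R : ℝ} {D f g : ℝ → ℝ}

theorem source_nonneg (h : AdmissibleCoefficients R D f g) : ∀ ρ ∈ Icc 0 R, 0 ≤ g ρ := by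
  have hg := h.continuousOn_source
  rw [← closure_Ioo h.range_pos.ne] at hg ⊢
  exact fun ρ hρ => le_on_closure (fun σ hσ => (h.source_pos σ hσ).le) continuousOn_const hg hρ

theorem intervalIntegrable_diffusivity (h : AdmissibleCoefficients R D f g) {ρ : ℝ}
    (hρ : ρ ∈ Icc 0 R) : IntervalIntegrable D volume 0 ρ :=
  ContinuousOn.intervalIntegrable <| h.continuousOn_diffusivity.mono <|
    ordConnected_Icc.uIcc_subset ⟨le_rfl, h.range_pos.le⟩ hρ

theorem hasDerivWithinAt_kirchhoff (h : AdmissibleCoefficients R D f g) {ρ : ℝ}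
    (hρ : ρ ∈ Icc 0 R) : HasDerivWithinAt (kirchhoff D) (D ρ) (Icc 0 R) ρ :=
  haveI := Fact.mk hρ
  intervalIntegral.integral_hasDerivWithinAt_right (h.intervalIntegrable_diffusivity hρ)
    (h.continuousOn_diffusivity.stronglyMeasurableAtFilter_nhdsWithin measurableSet_Icc ρ)
    (h.continuousOn_diffusivity ρ hρ)

theorem hasStrictDerivAt_kirchhoff (h : AdmissibleCoefficients R D f g) {ρ : ℝ}
    (hρ : ρ ∈ Ioo 0 R) : HasStrictDerivAt (kirchhoff D) (D ρ) ρ :=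
  intervalIntegral.integral_hasStrictDerivAt_right
    (h.intervalIntegrable_diffusivity (Ioo_subset_Icc_self hρ))
    ((h.continuousOn_diffusivity.mono Ioo_subset_Icc_self).stronglyMeasurableAtFilter
      isOpen_Ioo ρ hρ)
    (h.continuousOn_diffusivity.continuousAt (Icc_mem_nhds hρ.1 hρ.2))

theorem continuousOn_kirchhoff (h : AdmissibleCoefficients R D f g) :
    ContinuousOn (kirchhoff D) (Icc 0 R) :=
  fun _ hρ => (h.hasDerivWithinAt_kirchhoff hρ).continuousWithinAt

theorem monotoneOn_kirchhoff (h : AdmissibleCoefficients R D f g) :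
    MonotoneOn (kirchhoff D) (Icc 0 R) := by
  refine monotoneOn_of_deriv_nonneg (convex_Icc 0 R) h.continuousOn_kirchhoff ?_ ?_ <;>
  rw [interior_Icc] <;> intro ρ hρ
  · exact (h.hasStrictDerivAt_kirchhoff hρ).hasDerivAt.differentiableAt.differentiableWithinAt
  · exact (h.hasStrictDerivAt_kirchhoff hρ).hasDerivAt.deriv ▸ (h.diffusivity_pos ρ hρ).le

theorem hasDerivAt_convection (h : AdmissibleCoefficients R D f g) {ρ : ℝ} (hρ : ρ ∈ Ioo 0 R) :
    HasDerivAt f (deriv f ρ) ρ :=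
  ((h.differentiableOn_convection ρ (Ioo_subset_Icc_self hρ)).differentiableAt
    (Icc_mem_nhds hρ.1 hρ.2)).hasDerivAt

end AdmissibleCoefficients

/-- The integrated form of the profile equation on the open interval `I`: the diffusive flux `p` is
the derivative of the Kirchhoff transform of `φ`, and the total flux has derivative `-g(φ)`. Since
`φ` itself is not differentiated, sharp points are not exceptional. -/
structure HasFlux (R : ℝ) (D f g : ℝ → ℝ) (c : ℝ) (I : Set ℝ) (φ p : ℝ → ℝ) : Prop
    extends AdmissibleCoefficients R D f g where
  isOpen : IsOpen I
  ordConnected : I.OrdConnected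
  mapsTo : MapsTo φ I (Icc 0 R)
  continuousOn : ContinuousOn φ I
  hasDerivAt_kirchhoff_comp : ∀ ξ ∈ I, HasDerivAt (kirchhoff D ∘ φ) (p ξ) ξ
  hasDerivAt_totalFlux : ∀ ξ ∈ I, HasDerivAt (totalFlux f c φ p) (-g (φ ξ)) ξ

section Existence

variable {R c : ℝ} {D f g φ : ℝ → ℝ} {I : Set ℝ}

theorem IsTravelingWaveProfile.continuousOn_comp {u : ℝ → ℝ}
    (hφ : IsTravelingWaveProfile R D f g c I φ) (hu : ContinuousOn u (Icc 0 R)) :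
    ContinuousOn (fun ξ => u (φ ξ)) I :=
  hu.comp hφ.continuousOn hφ.mapsTo

theorem IsTravelingWaveProfile.locallyIntegrableOn_totalFlux
    (hφ : IsTravelingWaveProfile R D f g c I φ) (hf : ContinuousOn f (Icc 0 R)) :
    LocallyIntegrableOn (totalFlux f c φ (diffusionFlux D φ)) I :=
  (hφ.locallyIntegrableOn.sub
    ((hφ.continuousOn_comp hf).locallyIntegrableOn hφ.isOpen.measurableSet)).add
    ((continuousOn_const.mul hφ.continuousOn).locallyIntegrableOn hφ.isOpen.measurableSet)

theorem IsTravelingWaveProfile.integral_totalFlux_add_mul_deriv_eq_zero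
    (hφ : IsTravelingWaveProfile R D f g c I φ) (hf : ContinuousOn f (Icc 0 R))
    (hg : ContinuousOn g (Icc 0 R)) {G : ℝ → ℝ} (hG : ∀ ξ ∈ I, HasDerivAt G (g (φ ξ)) ξ)
    {ψ : ℝ → ℝ} (hψ : ContDiff ℝ ∞ ψ) (hψc : HasCompactSupport ψ) (hψI : tsupport ψ ⊆ I) :
    ∫ ξ, (totalFlux f c φ (diffusionFlux D φ) ξ + G ξ) * deriv ψ ξ = 0 := by
  have hψ' : Continuous (deriv ψ) := hψ.continuous_deriv (by simp)
  have hψ'I : tsupport (deriv ψ) ⊆ I := tsupport_deriv_subset.trans hψI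
  have hGloc : LocallyIntegrableOn G I :=
    (HasDerivAt.continuousOn hG).locallyIntegrableOn hφ.isOpen.measurableSet
  have hgloc := (hφ.continuousOn_comp hg).locallyIntegrableOn (μ := volume) hφ.isOpen.measurableSet
  have hflux := integrable_mul_of_tsupport_subset (hφ.locallyIntegrableOn_totalFlux hf) hψ'
    hψc.deriv hψ'I
  have hGψ' := integrable_mul_of_tsupport_subset hGloc hψ' hψc.deriv hψ'I
  have hGψ := integrable_mul_of_tsupport_subset hGloc hψ.continuous hψc hψI
  have hgψ := integrable_mul_of_tsupport_subset hgloc hψ.continuous hψc hψI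
  have hparts : ∫ ξ, G ξ * deriv ψ ξ = -∫ ξ, g (φ ξ) * ψ ξ :=
    integral_mul_deriv_eq_deriv_mul_of_integrable (fun ξ hξ => hG ξ (hψI hξ))
      (fun ξ _ => (hψ.differentiable (by simp) ξ).hasDerivAt) hGψ' hgψ hGψ
  have hweak : (∫ ξ, totalFlux f c φ (diffusionFlux D φ) ξ * deriv ψ ξ)
      - ∫ ξ, g (φ ξ) * ψ ξ = 0 := by
    rw [← integral_sub hflux hgψ, ← hφ.weak ψ hψ hψc hψI, eq_comm]
    refine setIntegral_eq_integral_of_forall_compl_eq_zero fun ξ hξ => ?_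
    have hψξ : ψ ξ = 0 := image_eq_zero_of_notMem_tsupport fun h => hξ (hψI h)
    have hψ'ξ : deriv ψ ξ = 0 := image_eq_zero_of_notMem_tsupport fun h => hξ (hψ'I h)
    rw [hψξ, hψ'ξ, mul_zero, mul_zero, sub_zero]
  simp only [add_mul]
  rw [integral_add hflux hGψ', hparts, ← sub_eq_add_neg, hweak]

theorem IsClassicalOn.continuousOn_diffusionFlux {U : Set ℝ} (hφ : IsClassicalOn R D f g c U φ)
    (hU : IsOpen U) : ContinuousOn (diffusionFlux D φ) U := by
  intro ξ hξ
  obtain ⟨ε, hε, hball⟩ := Metric.nhds_basis_closedBall.mem_iff.1 (hU.mem_nhds hξ)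
  rw [Real.closedBall_eq_Icc] at hball
  have hcont := (hφ.absolutelyContinuous (ξ - ε) (ξ + ε) (by linarith) hball).continuousOn
  rw [uIcc_of_le (by linarith)] at hcont
  exact (hcont.continuousAt (Icc_mem_nhds (by linarith) (by linarith))).continuousWithinAt

theorem IsTravelingWaveProfile.exists_ae_eq_totalFlux (hφ : IsTravelingWaveProfile R D f g c I φ)
    (hf : ContinuousOn f (Icc 0 R)) (hg : ContinuousOn g (Icc 0 R)) :
    ∃ W : ℝ → ℝ, (∀ ξ ∈ I, HasDerivAt W (-g (φ ξ)) ξ) ∧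
      ∀ᵐ ξ, ξ ∈ I → totalFlux f c φ (diffusionFlux D φ) ξ = W ξ := by
  obtain ⟨G, hG⟩ := exists_hasDerivAt_of_continuousOn hφ.isOpen hφ.ordConnected
    (hφ.continuousOn_comp hg)
  obtain ⟨C, hC⟩ := exists_ae_eq_const_of_forall_integral_mul_deriv_eq_zero hφ.isOpen
    hφ.ordConnected ((hφ.locallyIntegrableOn_totalFlux hf).add
      ((HasDerivAt.continuousOn hG).locallyIntegrableOn hφ.isOpen.measurableSet))
    fun ψ hψ hψc hψI => hφ.integral_totalFlux_add_mul_deriv_eq_zero hf hg hG hψ hψc hψI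
  exact ⟨fun ξ => C - G ξ, fun ξ hξ => (hG ξ hξ).const_sub C,
    hC.mono fun ξ hξ hξI => eq_sub_of_add_eq (hξ hξI)⟩

theorem IsClassicalOn.eqOn_totalFlux_of_ae_eq {U : Set ℝ} (hcl : IsClassicalOn R D f g c U φ)
    (hφ : IsTravelingWaveProfile R D f g c I φ) (hU : IsOpen U) (hUI : U ⊆ I)
    (hf : ContinuousOn f (Icc 0 R)) {W : ℝ → ℝ} (hW : ContinuousOn W I)
    (hae : ∀ᵐ ξ, ξ ∈ I → totalFlux f c φ (diffusionFlux D φ) ξ = W ξ) :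
    EqOn (totalFlux f c φ (diffusionFlux D φ)) W U := by
  refine Measure.eqOn_open_of_ae_eq (μ := volume) ?_ hU ?_ (hW.mono hUI)
  · rw [EventuallyEq, ae_restrict_iff' hU.measurableSet]
    exact hae.mono fun ξ hξ hξU => hξ (hUI hξU)
  · exact ((hcl.continuousOn_diffusionFlux hU).sub ((hφ.continuousOn_comp hf).mono hUI)).add
      (continuousOn_const.mul (hφ.continuousOn.mono hUI))

theorem IsTravelingWaveProfile.exists_hasFlux (hφ : IsTravelingWaveProfile R D f g c I φ)
    (hcs : IsClassicalOrSharp R D f g c I φ) (hco : AdmissibleCoefficients R D f g) :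
    ∃ p, HasFlux R D f g c I φ p := by
  obtain ⟨S, hS, -, -, hcl⟩ := hcs
  have hf := hco.differentiableOn_convection.continuousOn
  obtain ⟨W, hW, hae⟩ := hφ.exists_ae_eq_totalFlux hf hco.continuousOn_source
  have hWc : ContinuousOn W I := HasDerivAt.continuousOn hW
  set p : ℝ → ℝ := fun ξ => W ξ + f (φ ξ) - c * φ ξ with hp
  have hpW : totalFlux f c φ p = W := funext fun ξ => by simp only [totalFlux, hp]; ring
  have hpc : ContinuousOn p I :=
    (hWc.add (hφ.continuousOn_comp hf)).sub (continuousOn_const.mul hφ.continuousOn)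
  have hregular : ∀ ξ ∈ I \ S, HasDerivAt (kirchhoff D ∘ φ) (p ξ) ξ := by
    intro ξ hξ
    have hpξ : p ξ = D (φ ξ) * deriv φ ξ := by
      simp only [hp, ← hcl.eqOn_totalFlux_of_ae_eq hφ (hφ.isOpen.sdiff hS.isClosed) sdiff_subset
        hf hWc hae hξ, totalFlux, diffusionFlux]
      ring
    rw [hpξ]
    exact (hco.hasDerivWithinAt_kirchhoff (hφ.mapsTo hξ.1)).comp_hasDerivAt ξ
      (hcl.differentiableAt ξ hξ).hasDerivAt
      (mem_of_superset (hφ.isOpen.mem_nhds hξ.1) hφ.mapsTo)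
  refine ⟨p, hco, hφ.isOpen, hφ.ordConnected, hφ.mapsTo, hφ.continuousOn, fun ξ hξ => ?_,
    fun ξ hξ => hpW ▸ hW ξ hξ⟩
  have hI := hφ.isOpen.mem_nhds hξ
  refine hasDerivAt_of_eventually_hasDerivAt_nhdsNE ?_
    ((hφ.continuousOn_comp hco.continuousOn_kirchhoff).continuousAt hI) (hpc.continuousAt hI)
  filter_upwards [nhdsWithin_le_nhds hI, nhdsNE_le_cofinite ξ hS.compl_mem_cofinite] with η hη hηS
  exact hregular η ⟨hη, hηS⟩

end Existence

namespace HasFlux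

variable {R c : ℝ} {D f g φ p : ℝ → ℝ} {I : Set ℝ}

theorem antitoneOn_totalFlux (h : HasFlux R D f g c I φ p) : AntitoneOn (totalFlux f c φ p) I := by
  refine antitoneOn_of_deriv_nonpos h.ordConnected.convex
    (HasDerivAt.continuousOn h.hasDerivAt_totalFlux) ?_ ?_ <;>
  rw [h.isOpen.interior_eq] <;> intro ξ hξ
  · exact (h.hasDerivAt_totalFlux ξ hξ).differentiableAt.differentiableWithinAt
  · rw [(h.hasDerivAt_totalFlux ξ hξ).deriv, neg_nonpos]
    exact h.source_nonneg _ (h.mapsTo hξ)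

theorem eq_of_totalFlux_le (h : HasFlux R D f g c I φ p) {a b : ℝ} (ha : a ∈ I) (hb : b ∈ I)
    (hab : a ≤ b) (hW : totalFlux f c φ p a ≤ totalFlux f c φ p b) : φ a = φ b := by
  by_contra hne
  have hsub : Icc a b ⊆ I := h.ordConnected.out ha hb
  have hsource : ∀ y ∈ Ioo a b, g (φ y) = 0 := by
    intro y hy
    have hconst : totalFlux f c φ p =ᶠ[𝓝 y] fun _ => totalFlux f c φ p a := by
      filter_upwards [Icc_mem_nhds hy.1 hy.2] with x hx
      exact (h.antitoneOn_totalFlux ha (hsub hx) hx.1).antisymm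
        (hW.trans (h.antitoneOn_totalFlux (hsub hx) hb hx.2))
    have hderiv := h.hasDerivAt_totalFlux y (hsub (Ioo_subset_Icc_self hy))
    exact neg_eq_zero.1 (hderiv.unique ((hasDerivAt_const y _).congr_of_eventuallyEq hconst))
  obtain ⟨y, hy, hφy⟩ : ∃ y ∈ Ioo a b, φ y ∈ Ioo 0 R := by
    rcases lt_or_gt_of_ne hne with hlt | hlt <;> obtain ⟨ρ, hρl, hρr⟩ := exists_between hlt
    · obtain ⟨y, hy, rfl⟩ := intermediate_value_Ioo hab (h.continuousOn.mono hsub) ⟨hρl, hρr⟩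
      exact ⟨y, hy, (h.mapsTo ha).1.trans_lt hρl, hρr.trans_le (h.mapsTo hb).2⟩
    · obtain ⟨y, hy, rfl⟩ := intermediate_value_Ioo' hab (h.continuousOn.mono hsub) ⟨hρl, hρr⟩
      exact ⟨y, hy, (h.mapsTo hb).1.trans_lt hρl, hρr.trans_le (h.mapsTo ha).2⟩
  exact (h.source_pos _ hφy).ne' (hsource y hy)

theorem flux_eq_zero_of_isLocalExtr (h : HasFlux R D f g c I φ p) {x : ℝ} (hx : x ∈ I)
    (hext : IsLocalExtr φ x) : p x = 0 := by
  have hmaps : ∀ᶠ y in 𝓝 x, φ y ∈ Icc 0 R := (h.isOpen.eventually_mem hx).mono h.mapsTo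
  refine IsLocalExtr.hasDerivAt_eq_zero (hext.imp (fun hmin => ?_) fun hmax => ?_)
    (h.hasDerivAt_kirchhoff_comp x hx)
  · filter_upwards [hmaps, hmin] with y hy hyx
    exact h.monotoneOn_kirchhoff (h.mapsTo hx) hy hyx
  · filter_upwards [hmaps, hmax] with y hy hyx
    exact h.monotoneOn_kirchhoff hy (h.mapsTo hx) hyx

theorem flux_eq_zero_of_eq_zero (h : HasFlux R D f g c I φ p) {x : ℝ} (hx : x ∈ I)
    (h0 : φ x = 0) : p x = 0 :=
  h.flux_eq_zero_of_isLocalExtr hx <| .inl <|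
    (h.isOpen.eventually_mem hx).mono fun _ hy => h0.trans_le (h.mapsTo hy).1

theorem flux_eq_zero_of_eq_range (h : HasFlux R D f g c I φ p) {x : ℝ} (hx : x ∈ I)
    (hR : φ x = R) : p x = 0 :=
  h.flux_eq_zero_of_isLocalExtr hx <| .inr <|
    (h.isOpen.eventually_mem hx).mono fun _ hy => (h.mapsTo hy).2.trans_eq hR.symm

theorem hasDerivAt_profile (h : HasFlux R D f g c I φ p) {x : ℝ} (hx : x ∈ I)
    (hφx : φ x ∈ Ioo 0 R) : HasDerivAt φ (p x / D (φ x)) x := by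
  have hE := h.hasStrictDerivAt_kirchhoff hφx
  have hD := (h.diffusivity_pos _ hφx).ne'
  have hinv : hE.localInverse _ _ _ hD ∘ (kirchhoff D ∘ φ) =ᶠ[𝓝 x] φ :=
    (h.continuousOn.continuousAt (h.isOpen.mem_nhds hx)).eventually
      (hE.eventually_left_inverse hD)
  rw [div_eq_inv_mul]
  exact (HasDerivAt.comp x (hE.to_localInverse hD).hasDerivAt
    (h.hasDerivAt_kirchhoff_comp x hx)).congr_of_eventuallyEq hinv.symm

theorem hasDerivAt_flux (h : HasFlux R D f g c I φ p) {x : ℝ} (hx : x ∈ I)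
    (hφx : φ x ∈ Ioo 0 R) :
    HasDerivAt p ((deriv f (φ x) - c) * (p x / D (φ x)) - g (φ x)) x := by
  have hφ' := h.hasDerivAt_profile hx hφx
  have hp : p = fun ξ => totalFlux f c φ p ξ + f (φ ξ) - c * φ ξ :=
    funext fun ξ => by simp only [totalFlux]; ring
  rw [hp]
  refine (((h.hasDerivAt_totalFlux x hx).add ((h.hasDerivAt_convection hφx).comp x hφ')).sub
    (hφ'.const_mul c)).congr_deriv ?_
  simp only [totalFlux]
  ring

/-- At a minimum the flux `p` vanishes, so `p' = -g(φ) < 0`: the second-derivative test makes the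
Kirchhoff transform of `φ` locally constant, contradicting `p' ≠ 0`. -/
theorem not_isLocalMin (h : HasFlux R D f g c I φ p) {x : ℝ} (hx : x ∈ I)
    (hφx : φ x ∈ Ioo 0 R) : ¬ IsLocalMin φ x := by
  intro hmin
  have hp0 := h.flux_eq_zero_of_isLocalExtr hx (.inl hmin)
  have hderiv : deriv (kirchhoff D ∘ φ) =ᶠ[𝓝 x] p :=
    (h.isOpen.eventually_mem hx).mono fun y hy => (h.hasDerivAt_kirchhoff_comp y hy).deriv
  have hderiv2 : deriv (deriv (kirchhoff D ∘ φ)) x < 0 := by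
    rw [hderiv.deriv_eq, (h.hasDerivAt_flux hx hφx).deriv, hp0]
    simpa using h.source_pos _ hφx
  have hmax : IsLocalMax (kirchhoff D ∘ φ) x := isLocalMax_of_deriv_deriv_neg hderiv2
    (hderiv.eq_of_nhds.trans hp0) (h.hasDerivAt_kirchhoff_comp x hx).continuousAt
  have hconst : kirchhoff D ∘ φ =ᶠ[𝓝 x] fun _ => kirchhoff D (φ x) := by
    filter_upwards [hmax, hmin, h.isOpen.eventually_mem hx] with y hymax hymin hy
    exact hymax.antisymm (h.monotoneOn_kirchhoff (h.mapsTo hx) (h.mapsTo hy) hymin)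
  have : deriv (deriv (kirchhoff D ∘ φ)) x = 0 := by
    simpa using hconst.deriv.deriv_eq
  exact hderiv2.ne this

theorem mapClusterPt_totalFlux (h : HasFlux R D f g c I φ p) {F : Filter ℝ} [F.NeBot]
    [TendstoIxxClass Icc F F] (hF : Tendsto (· + 1) F F) (hI : I ∈ F) {l : ℝ} (hl : l ∈ Icc 0 R)
    (hφ : Tendsto φ F (𝓝 l)) : MapClusterPt (c * l - f l) F (totalFlux f c φ p) := by
  have hφ' : Tendsto φ F (𝓝[Icc 0 R] l) :=
    tendsto_nhdsWithin_iff.2 ⟨hφ, mem_of_superset hI h.mapsTo⟩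
  have hE : Tendsto (kirchhoff D ∘ φ) F (𝓝 (kirchhoff D l)) :=
    (h.continuousOn_kirchhoff l hl).tendsto.comp hφ'
  have hf : Tendsto (f ∘ φ) F (𝓝 (f l)) :=
    (h.differentiableOn_convection.continuousOn l hl).tendsto.comp hφ'
  obtain ⟨U, hUF, hU⟩ := mapClusterPt_iff_ultrafilter.1 <| mapClusterPt_zero_of_hasDerivAt hF
    (mem_of_superset hI h.hasDerivAt_kirchhoff_comp) hE
  refine mapClusterPt_iff_ultrafilter.2 ⟨U, hUF, ?_⟩
  have := (hU.sub (hf.mono_left hUF)).add ((hφ.mono_left hUF).const_mul c)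
  rwa [zero_sub, neg_add_eq_sub] at this

theorem isLUB_totalFlux (h : HasFlux R D f g c I φ p) (hI : I ∈ atBot) {l : ℝ}
    (hl : l ∈ Icc 0 R) (hφ : Tendsto φ atBot (𝓝 l)) :
    IsLUB (totalFlux f c φ p '' I) (c * l - f l) := by
  have hcluster := h.mapClusterPt_totalFlux (tendsto_atBot_add_const_right _ 1 tendsto_id) hI hl hφ
  refine isLUB_of_mem_closure ?_ <| isClosed_closure.mem_of_mapClusterPt hcluster <|
    mem_of_superset hI fun ξ hξ => subset_closure (mem_image_of_mem _ hξ)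
  rintro _ ⟨ξ, hξ, rfl⟩
  refine isClosed_Ici.mem_of_mapClusterPt hcluster ?_
  filter_upwards [hI, eventually_le_atBot ξ] with η hη hηξ
  exact h.antitoneOn_totalFlux hη hξ hηξ

theorem le_totalFlux (h : HasFlux R D f g c I φ p) (hI : I ∈ atTop) {l : ℝ} (hl : l ∈ Icc 0 R)
    (hφ : Tendsto φ atTop (𝓝 l)) {ξ : ℝ} (hξ : ξ ∈ I) : c * l - f l ≤ totalFlux f c φ p ξ := by
  have hcluster := h.mapClusterPt_totalFlux (tendsto_atTop_add_const_right _ 1 tendsto_id) hI hl hφ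
  refine isClosed_Iic.mem_of_mapClusterPt hcluster ?_
  filter_upwards [hI, eventually_ge_atTop ξ] with η hη hξη
  exact h.antitoneOn_totalFlux hξ hη hξη

theorem eq_zero_of_le (h : HasFlux R D f g c I φ p)
    (hW : ∀ ξ ∈ I, c * 0 - f 0 ≤ totalFlux f c φ p ξ) {a b : ℝ} (ha : a ∈ I) (hb : b ∈ I)
    (hab : a ≤ b) (ha0 : φ a = 0) : φ b = 0 := by
  rw [← h.eq_of_totalFlux_le ha hb hab, ha0]
  have hpa := h.flux_eq_zero_of_eq_zero ha ha0
  calc totalFlux f c φ p a = c * 0 - f 0 := by rw [totalFlux, hpa, ha0]; ring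
    _ ≤ totalFlux f c φ p b := hW b hb

theorem eq_range_of_le (h : HasFlux R D f g c I φ p) (hI : I ∈ atBot)
    (hφ : Tendsto φ atBot (𝓝 R)) {a b : ℝ} (ha : a ∈ I) (hb : b ∈ I) (hab : a ≤ b)
    (hbR : φ b = R) : φ a = R := by
  rw [h.eq_of_totalFlux_le ha hb hab, hbR]
  have hpb := h.flux_eq_zero_of_eq_range hb hbR
  calc totalFlux f c φ p a ≤ c * R - f R :=
        (h.isLUB_totalFlux hI ⟨h.range_pos.le, le_rfl⟩ hφ).1 (mem_image_of_mem _ ha)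
    _ = totalFlux f c φ p b := by rw [totalFlux, hpb, hbR]; ring

/-- If the profile increased from `a` to `b`, then its minimum over a large interval ending at `b`
would be interior, hence `0`; but `0`, once attained, is never left. -/
theorem antitoneOn_of_tendsto_atBot (h : HasFlux R D f g c I φ p) (hI : I ∈ atBot)
    (hφ : Tendsto φ atBot (𝓝 R)) (hW : ∀ ξ ∈ I, c * 0 - f 0 ≤ totalFlux f c φ p ξ) :
    AntitoneOn φ I := by
  intro a ha b hb hab
  by_contra! hlt
  have hbR : φ b < R := (h.mapsTo hb).2.lt_of_ne fun hbR =>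
    hlt.ne (h.eq_range_of_le hI hφ ha hb hab hbR ▸ hbR.symm)
  obtain ⟨a', ⟨ha'I, hba'⟩, ha'a⟩ := ((eventually_mem_set.2 hI).and
    (hφ.eventually_const_lt hbR) |>.and (eventually_lt_atBot a)).exists
  have hsub : Icc a' b ⊆ I := h.ordConnected.out ha'I hb
  have haIcc : a ∈ Icc a' b := ⟨ha'a.le, hab⟩
  obtain ⟨m, hm, hmin⟩ := isCompact_Icc.exists_isMinOn ⟨a, haIcc⟩ (h.continuousOn.mono hsub)
  have hmb : φ m < φ b := (hmin haIcc).trans_lt hlt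
  have hmIoo : m ∈ Ioo a' b := ⟨hm.1.lt_of_ne (by rintro rfl; exact hmb.not_gt hba'),
    hm.2.lt_of_ne (by rintro rfl; exact hmb.false)⟩
  rcases (h.mapsTo (hsub hm)).1.eq_or_lt with hm0 | hm0
  · exact hmb.ne (hm0.symm.trans (h.eq_zero_of_le hW (hsub hm) hb hm.2 hm0.symm).symm)
  · exact h.not_isLocalMin (hsub hm) ⟨hm0, hmb.trans hbR⟩
      (hmin.isLocalMin (Icc_mem_nhds hmIoo.1 hmIoo.2))

theorem flux_nonpos (h : HasFlux R D f g c I φ p) (hφ : AntitoneOn φ I) {x : ℝ} (hx : x ∈ I) :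
    p x ≤ 0 := by
  have hE : AntitoneOn (kirchhoff D ∘ φ) I := fun y hy z hz hyz =>
    h.monotoneOn_kirchhoff (h.mapsTo hz) (h.mapsTo hy) (hφ hy hz hyz)
  rw [← ((h.hasDerivAt_kirchhoff_comp x hx).hasDerivWithinAt.derivWithin
    (h.isOpen.uniqueDiffWithinAt hx))]
  exact hE.derivWithin_nonpos

theorem flux_neg (h : HasFlux R D f g c I φ p) (hφ : AntitoneOn φ I) {x : ℝ} (hx : x ∈ I)
    (hφx : φ x ∈ Ioo 0 R) : p x < 0 := by
  refine (h.flux_nonpos hφ hx).lt_of_ne fun hp0 => ?_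
  have hmax : IsLocalMax p x :=
    (h.isOpen.eventually_mem hx).mono fun y hy => (h.flux_nonpos hφ hy).trans_eq hp0.symm
  have hp' := hmax.hasDerivAt_eq_zero (h.hasDerivAt_flux hx hφx)
  rw [hp0, zero_div, mul_zero, zero_sub, neg_eq_zero] at hp'
  exact (h.source_pos _ hφx).ne' hp'

theorem pos_of_source_zero_pos (h : HasFlux R D f g c I φ p) (hφ : AntitoneOn φ I)
    (hg0 : 0 < g 0) {x : ℝ} (hx : x ∈ I) : 0 < φ x := by
  refine (h.mapsTo hx).1.lt_of_ne fun hx0 => hg0.ne' ?_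
  have hzero : ∀ y ∈ I, x ≤ y → φ y = 0 := fun y hy hxy =>
    ((hφ hx hy hxy).trans_eq hx0.symm).antisymm (h.mapsTo hy).1
  have hW : ∀ y ∈ I, x ≤ y → totalFlux f c φ p y = -f 0 := fun y hy hxy => by
    simp [totalFlux, h.flux_eq_zero_of_eq_zero hy (hzero y hy hxy), hzero y hy hxy]
  have hconst : totalFlux f c φ p =ᶠ[𝓝[≥] x] fun _ => -f 0 := by
    filter_upwards [nhdsWithin_le_nhds (h.isOpen.mem_nhds hx), self_mem_nhdsWithin] using hW
  have hderiv := (h.hasDerivAt_totalFlux x hx).hasDerivWithinAt (s := Ici x)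
  rw [← hx0] at hderiv
  exact neg_eq_zero.1 <| (uniqueDiffWithinAt_Ici x).eq_deriv _ hderiv <|
    (hasDerivWithinAt_const x (Ici x) (-f 0)).congr_of_eventuallyEq hconst (hW x hx le_rfl)

end HasFlux

/-- The part of `I` on which the profile `φ` takes values strictly between its end states `0`
and `R`. -/
def frontZone (R : ℝ) (I : Set ℝ) (φ : ℝ → ℝ) : Set ℝ := I ∩ φ ⁻¹' Ioo 0 R

/-- The inverse of `φ` on its front zone, that is, position as a function of density. It is
meaningful only at the values attained on the front zone. -/
noncomputable def frontInverse (R : ℝ) (I : Set ℝ) (φ : ℝ → ℝ) : ℝ → ℝ :=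
  Function.invFunOn φ (frontZone R I φ)

/-- The phase-plane variable `z(ρ)`: the diffusive flux `p` as a function of the density. -/
noncomputable def phaseFlux (R : ℝ) (I : Set ℝ) (φ p : ℝ → ℝ) (ρ : ℝ) : ℝ :=
  p (frontInverse R I φ ρ)

/-- A decreasing profile with flux `p` which leaves `R` at `-∞`, translated so that
`φ(0) = R / 2`. Wavefronts and semi-wavefronts are treated together through this notion. -/
structure DecreasingFront (R : ℝ) (D f g : ℝ → ℝ) (c : ℝ) (I : Set ℝ) (φ p : ℝ → ℝ) : Prop
    extends HasFlux R D f g c I φ p where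
  Iic_subset : Iic 0 ⊆ I
  antitoneOn : AntitoneOn φ I
  tendsto_atBot : Tendsto φ atBot (𝓝 R)
  apply_zero : φ 0 = R / 2

namespace DecreasingFront

section Single

variable {R c : ℝ} {D f g φ p : ℝ → ℝ} {I : Set ℝ}

theorem mem_atBot (h : DecreasingFront R D f g c I φ p) : I ∈ atBot :=
  mem_of_superset (Iic_mem_atBot 0) h.Iic_subset

theorem zero_mem (h : DecreasingFront R D f g c I φ p) : (0 : ℝ) ∈ I :=
  h.Iic_subset self_mem_Iic

theorem half_mem_Ioo (h : DecreasingFront R D f g c I φ p) : R / 2 ∈ Ioo 0 R :=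
  ⟨half_pos h.range_pos, half_lt_self h.range_pos⟩

theorem zero_mem_frontZone (h : DecreasingFront R D f g c I φ p) : (0 : ℝ) ∈ frontZone R I φ :=
  ⟨h.zero_mem, mem_preimage.2 (h.apply_zero.symm ▸ h.half_mem_Ioo)⟩

theorem isOpen_frontZone (h : DecreasingFront R D f g c I φ p) : IsOpen (frontZone R I φ) :=
  h.continuousOn.isOpen_inter_preimage h.isOpen isOpen_Ioo

theorem ordConnected_frontZone (h : DecreasingFront R D f g c I φ p) :
    (frontZone R I φ).OrdConnected := by
  refine ⟨fun a ha b hb x hx => ?_⟩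
  have hxI : x ∈ I := h.ordConnected.out ha.1 hb.1 hx
  exact ⟨hxI, hb.2.1.trans_le (h.antitoneOn hxI hb.1 hx.2),
    (h.antitoneOn ha.1 hxI hx.1).trans_lt ha.2.2⟩

theorem strictAntiOn_frontZone (h : DecreasingFront R D f g c I φ p) :
    StrictAntiOn φ (frontZone R I φ) := by
  refine strictAntiOn_of_deriv_neg h.ordConnected_frontZone.convex
    (h.continuousOn.mono inter_subset_left) fun x hx => ?_
  rw [h.isOpen_frontZone.interior_eq] at hx
  rw [(h.hasDerivAt_profile hx.1 hx.2).deriv]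
  exact div_neg_of_neg_of_pos (h.flux_neg h.antitoneOn hx.1 hx.2) (h.diffusivity_pos _ hx.2)

theorem apply_lt_apply (h : DecreasingFront R D f g c I φ p) {a b : ℝ} (ha : a ∈ I) (hb : b ∈ I)
    (hab : a < b) (hφ : φ a ∈ Ioo 0 R ∨ φ b ∈ Ioo 0 R) : φ b < φ a := by
  refine (h.antitoneOn ha hb hab.le).lt_of_ne fun heq => ?_
  have hφa : φ a ∈ Ioo 0 R := hφ.elim id fun hφb => heq ▸ hφb
  have hφb : φ b ∈ Ioo 0 R := heq ▸ hφa
  exact (h.strictAntiOn_frontZone ⟨ha, hφa⟩ ⟨hb, hφb⟩ hab).ne heq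

theorem half_lt_apply_of_neg (h : DecreasingFront R D f g c I φ p) {ξ : ℝ} (hξ : ξ < 0) :
    R / 2 < φ ξ :=
  h.apply_zero ▸ h.apply_lt_apply (h.Iic_subset hξ.le) h.zero_mem hξ (.inr h.zero_mem_frontZone.2)

theorem Ico_subset_image_frontZone (h : DecreasingFront R D f g c I φ p) {ρ : ℝ}
    (hρ : ρ ∈ φ '' frontZone R I φ) : Ico ρ R ⊆ φ '' frontZone R I φ := by
  obtain ⟨b, hb, rfl⟩ := hρ
  intro σ hσ
  obtain ⟨a, ⟨haI, hσa⟩, hab⟩ := ((eventually_mem_set.2 h.mem_atBot).and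
    (h.tendsto_atBot.eventually_const_lt hσ.2) |>.and (eventually_le_atBot b)).exists
  have hsub : Icc a b ⊆ I := h.ordConnected.out haI hb.1
  obtain ⟨y, hy, rfl⟩ := intermediate_value_Icc' hab (h.continuousOn.mono hsub) ⟨hσ.1, hσa.le⟩
  exact ⟨y, ⟨hsub hy, hb.2.1.trans_le hσ.1, hσ.2⟩, rfl⟩

theorem half_mem_image_frontZone (h : DecreasingFront R D f g c I φ p) :
    R / 2 ∈ φ '' frontZone R I φ :=
  ⟨0, h.zero_mem_frontZone, h.apply_zero⟩

theorem lt_range_of_mem_image_frontZone {ρ : ℝ} (hρ : ρ ∈ φ '' frontZone R I φ) : ρ < R := by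
  obtain ⟨ξ, hξ, rfl⟩ := hρ
  exact hξ.2.2

theorem ordConnected_image_frontZone (h : DecreasingFront R D f g c I φ p) :
    (φ '' frontZone R I φ).OrdConnected :=
  ⟨fun _ hρ _ hσ _ hτ => h.Ico_subset_image_frontZone hρ
    ⟨hτ.1, hτ.2.trans_lt (lt_range_of_mem_image_frontZone hσ)⟩⟩

theorem frontInverse_mem {ρ : ℝ} (hρ : ρ ∈ φ '' frontZone R I φ) :
    frontInverse R I φ ρ ∈ frontZone R I φ :=
  Function.invFunOn_mem hρ

theorem apply_frontInverse {ρ : ℝ} (hρ : ρ ∈ φ '' frontZone R I φ) :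
    φ (frontInverse R I φ ρ) = ρ :=
  Function.invFunOn_eq hρ

theorem frontInverse_apply (h : DecreasingFront R D f g c I φ p) {ξ : ℝ}
    (hξ : ξ ∈ frontZone R I φ) : frontInverse R I φ (φ ξ) = ξ :=
  h.strictAntiOn_frontZone.injOn.leftInvOn_invFunOn hξ

theorem frontInverse_half (h : DecreasingFront R D f g c I φ p) :
    frontInverse R I φ (R / 2) = 0 :=
  h.apply_zero ▸ h.frontInverse_apply h.zero_mem_frontZone

theorem lt_frontInverse_iff (h : DecreasingFront R D f g c I φ p) {ρ ξ : ℝ}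
    (hρ : ρ ∈ φ '' frontZone R I φ) (hξ : ξ ∈ I) : ξ < frontInverse R I φ ρ ↔ ρ < φ ξ := by
  have hT := frontInverse_mem hρ
  constructor <;> intro hlt
  · exact apply_frontInverse hρ ▸ h.apply_lt_apply hξ hT.1 hlt (.inr hT.2)
  · exact h.antitoneOn.reflect_lt hT.1 hξ (by rwa [apply_frontInverse hρ])

theorem frontInverse_lt_iff (h : DecreasingFront R D f g c I φ p) {ρ ξ : ℝ}
    (hρ : ρ ∈ φ '' frontZone R I φ) (hξ : ξ ∈ I) : frontInverse R I φ ρ < ξ ↔ φ ξ < ρ := by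
  have hT := frontInverse_mem hρ
  constructor <;> intro hlt
  · exact (h.apply_lt_apply hT.1 hξ hlt (.inl hT.2)).trans_eq (apply_frontInverse hρ)
  · exact h.antitoneOn.reflect_lt hξ hT.1 (by rwa [apply_frontInverse hρ])

theorem phaseFlux_neg (h : DecreasingFront R D f g c I φ p) {ρ : ℝ}
    (hρ : ρ ∈ φ '' frontZone R I φ) : phaseFlux R I φ p ρ < 0 :=
  h.flux_neg h.antitoneOn (frontInverse_mem hρ).1 (frontInverse_mem hρ).2

theorem hasDerivAt_frontInverse (h : DecreasingFront R D f g c I φ p) {ρ : ℝ}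
    (hρ : ρ ∈ φ '' frontZone R I φ) :
    HasDerivAt (frontInverse R I φ) (D ρ / phaseFlux R I φ p ρ) ρ := by
  obtain ⟨ξ, hξ, rfl⟩ := hρ
  have hz : phaseFlux R I φ p (φ ξ) = p ξ := by rw [phaseFlux, h.frontInverse_apply hξ]
  rw [hz, ← inv_div]
  exact hasDerivAt_invFunOn (h.isOpen_frontZone.mem_nhds hξ)
    (h.continuousOn.mono inter_subset_left) h.strictAntiOn_frontZone
    (h.hasDerivAt_profile hξ.1 hξ.2)
    (div_ne_zero (h.flux_neg h.antitoneOn hξ.1 hξ.2).ne (h.diffusivity_pos _ hξ.2).ne')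

theorem hasDerivAt_phaseFlux (h : DecreasingFront R D f g c I φ p) {ρ : ℝ}
    (hρ : ρ ∈ φ '' frontZone R I φ) :
    HasDerivAt (phaseFlux R I φ p) (deriv f ρ - c - D ρ * g ρ / phaseFlux R I φ p ρ) ρ := by
  have hT := frontInverse_mem hρ
  have hρ' : ρ ∈ Ioo 0 R := apply_frontInverse hρ ▸ hT.2
  have hp := h.hasDerivAt_flux hT.1 hT.2
  rw [apply_frontInverse hρ] at hp
  refine (hp.comp ρ (h.hasDerivAt_frontInverse hρ)).congr_deriv ?_
  have hz := (h.phaseFlux_neg hρ).ne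
  have hDρ := (h.diffusivity_pos ρ hρ').ne'
  rw [phaseFlux] at hz ⊢
  field_simp

theorem exists_mem_frontZone_lt_totalFlux (h : DecreasingFront R D f g c I φ p) {b : ℝ}
    (hb : b < c * R - f R) : ∃ ξ ∈ frontZone R I φ, b < totalFlux f c φ p ξ := by
  rcases lt_or_ge b (totalFlux f c φ p 0) with h0 | h0
  · exact ⟨0, h.zero_mem_frontZone, h0⟩
  obtain ⟨b', hbb', hb'⟩ := exists_between hb
  obtain ⟨_, ⟨a, ha, rfl⟩, hb'a⟩ := (lt_isLUB_iff
    (h.isLUB_totalFlux h.mem_atBot ⟨h.range_pos.le, le_rfl⟩ h.tendsto_atBot)).1 hb'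
  have ha0 : a < 0 :=
    h.antitoneOn_totalFlux.reflect_lt h.zero_mem ha ((h0.trans_lt hbb').trans hb'a)
  have hsub : Icc a 0 ⊆ I := h.ordConnected.out ha h.zero_mem
  obtain ⟨y, hy, hWy⟩ := intermediate_value_Icc' ha0.le
    ((HasDerivAt.continuousOn h.hasDerivAt_totalFlux).mono hsub) ⟨h0.trans hbb'.le, hb'a.le⟩
  have hyI := hsub hy
  refine ⟨y, ⟨hyI, ?_, (h.mapsTo hyI).2.lt_of_ne fun hyR => ?_⟩, hbb'.trans_eq hWy.symm⟩
  · exact h.zero_mem_frontZone.2.1.trans_le (h.antitoneOn hyI h.zero_mem hy.2)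
  · rw [totalFlux, h.flux_eq_zero_of_eq_range hyI hyR, hyR] at hWy
    linarith

theorem tendsto_phaseFlux (h : DecreasingFront R D f g c I φ p) :
    Tendsto (phaseFlux R I φ p) (𝓝[<] R) (𝓝 0) := by
  have himage : ∀ᶠ ρ in 𝓝[<] R, ρ ∈ φ '' frontZone R I φ := mem_of_superset
    (Ico_mem_nhdsLT h.half_mem_Ioo.2) (h.Ico_subset_image_frontZone h.half_mem_image_frontZone)
  have hW : Tendsto (fun ρ => totalFlux f c φ p (frontInverse R I φ ρ)) (𝓝[<] R)
      (𝓝 (c * R - f R)) := by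
    refine tendsto_order.2 ⟨fun b hb => ?_, fun b hb => ?_⟩
    · obtain ⟨ξ, hξ, hbξ⟩ := h.exists_mem_frontZone_lt_totalFlux hb
      filter_upwards [himage, Ioo_mem_nhdsLT hξ.2.2] with ρ hρ hξρ
      exact hbξ.trans_le (h.antitoneOn_totalFlux (frontInverse_mem hρ).1 hξ.1
        ((h.frontInverse_lt_iff hρ hξ.1).2 hξρ.1).le)
    · filter_upwards [himage] with ρ hρ
      exact ((h.isLUB_totalFlux h.mem_atBot ⟨h.range_pos.le, le_rfl⟩ h.tendsto_atBot).1
        (mem_image_of_mem _ (frontInverse_mem hρ).1)).trans_lt hb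
  have hf : Tendsto f (𝓝[<] R) (𝓝 (f R)) :=
    (h.differentiableOn_convection.continuousOn R ⟨h.range_pos.le, le_rfl⟩).mono_left <|
      nhdsWithin_le_of_mem (Icc_mem_nhdsLT h.range_pos)
  have hc : Tendsto (fun ρ => c * ρ) (𝓝[<] R) (𝓝 (c * R)) :=
    (continuous_const_mul c).continuousWithinAt
  have hlim := (hW.add hf).sub hc
  rw [sub_add_cancel, sub_self] at hlim
  refine hlim.congr' (himage.mono fun ρ hρ => ?_)
  rw [totalFlux, apply_frontInverse hρ, phaseFlux]
  ring

end Single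

section Comparison

variable {R c : ℝ} {D f g₁ g₂ φ₁ φ₂ p₁ p₂ : ℝ → ℝ} {I₁ I₂ : Set ℝ}

theorem phaseFlux_lt_phaseFlux (h₁ : DecreasingFront R D f g₁ c I₁ φ₁ p₁)
    (h₂ : DecreasingFront R D f g₂ c I₂ φ₂ p₂) (hg : ∀ ρ ∈ Ioo 0 R, g₂ ρ < g₁ ρ) {ρ : ℝ}
    (hρ₁ : ρ ∈ φ₁ '' frontZone R I₁ φ₁) (hρ₂ : ρ ∈ φ₂ '' frontZone R I₂ φ₂) :
    phaseFlux R I₁ φ₁ p₁ ρ < phaseFlux R I₂ φ₂ p₂ ρ := by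
  have hρ : ρ ∈ Ioo 0 R := apply_frontInverse hρ₁ ▸ (frontInverse_mem hρ₁).2
  have hIoo : Ico ρ R ⊆ Ioo 0 R := fun σ hσ => ⟨hρ.1.trans_le hσ.1, hσ.2⟩
  have him₁ := h₁.Ico_subset_image_frontZone hρ₁
  have him₂ := h₂.Ico_subset_image_frontZone hρ₂
  exact lt_of_hasDerivAt_sub_div hρ.2 (fun σ hσ => h₁.hasDerivAt_phaseFlux (him₁ hσ))
    (fun σ hσ => h₂.hasDerivAt_phaseFlux (him₂ hσ)) (fun σ hσ => h₁.phaseFlux_neg (him₁ hσ))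
    (fun σ hσ => (mul_pos (h₂.diffusivity_pos σ (hIoo hσ)) (h₂.source_pos σ (hIoo hσ))).le)
    (fun σ hσ => mul_lt_mul_of_pos_left (hg σ (hIoo hσ)) (h₂.diffusivity_pos σ (hIoo hσ)))
    h₁.tendsto_phaseFlux h₂.tendsto_phaseFlux

theorem strictMonoOn_frontInverse_sub (h₁ : DecreasingFront R D f g₁ c I₁ φ₁ p₁)
    (h₂ : DecreasingFront R D f g₂ c I₂ φ₂ p₂) (hg : ∀ ρ ∈ Ioo 0 R, g₂ ρ < g₁ ρ) :
    StrictMonoOn (frontInverse R I₁ φ₁ - frontInverse R I₂ φ₂)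
      (φ₁ '' frontZone R I₁ φ₁ ∩ φ₂ '' frontZone R I₂ φ₂) := by
  have hderiv := fun ρ (hρ : ρ ∈ φ₁ '' frontZone R I₁ φ₁ ∩ φ₂ '' frontZone R I₂ φ₂) =>
    (h₁.hasDerivAt_frontInverse hρ.1).sub (h₂.hasDerivAt_frontInverse hρ.2)
  refine strictMonoOn_of_deriv_pos
    (h₁.ordConnected_image_frontZone.inter h₂.ordConnected_image_frontZone).convex
    (HasDerivAt.continuousOn hderiv) fun ρ hρ => ?_
  obtain ⟨hρ₁, hρ₂⟩ := interior_subset hρ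
  have hDρ : 0 < D ρ := h₁.diffusivity_pos ρ (apply_frontInverse hρ₁ ▸ (frontInverse_mem hρ₁).2)
  rw [(hderiv ρ ⟨hρ₁, hρ₂⟩).deriv, sub_pos, div_eq_mul_inv, div_eq_mul_inv]
  exact mul_lt_mul_of_pos_left ((inv_lt_inv_of_neg (h₂.phaseFlux_neg hρ₂)
    (h₁.phaseFlux_neg hρ₁)).2 (h₁.phaseFlux_lt_phaseFlux h₂ hg hρ₁ hρ₂)) hDρ

theorem frontInverse_lt_of_half_lt (h₁ : DecreasingFront R D f g₁ c I₁ φ₁ p₁)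
    (h₂ : DecreasingFront R D f g₂ c I₂ φ₂ p₂) (hg : ∀ ρ ∈ Ioo 0 R, g₂ ρ < g₁ ρ) {ρ : ℝ}
    (hρ : ρ ∈ Ioo (R / 2) R) : frontInverse R I₂ φ₂ ρ < frontInverse R I₁ φ₁ ρ := by
  have hhalf₁ := h₁.half_mem_image_frontZone
  have hhalf₂ := h₂.half_mem_image_frontZone
  have hlt := h₁.strictMonoOn_frontInverse_sub h₂ hg ⟨hhalf₁, hhalf₂⟩
    ⟨h₁.Ico_subset_image_frontZone hhalf₁ (Ioo_subset_Ico_self hρ),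
      h₂.Ico_subset_image_frontZone hhalf₂ (Ioo_subset_Ico_self hρ)⟩ hρ.1
  simpa only [Pi.sub_apply, h₁.frontInverse_half, h₂.frontInverse_half, sub_self,
    sub_pos] using hlt

theorem frontInverse_lt_of_lt_half (h₁ : DecreasingFront R D f g₁ c I₁ φ₁ p₁)
    (h₂ : DecreasingFront R D f g₂ c I₂ φ₂ p₂) (hg : ∀ ρ ∈ Ioo 0 R, g₂ ρ < g₁ ρ) {ρ : ℝ}
    (hρ₁ : ρ ∈ φ₁ '' frontZone R I₁ φ₁) (hρ₂ : ρ ∈ φ₂ '' frontZone R I₂ φ₂) (hρ : ρ < R / 2) :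
    frontInverse R I₁ φ₁ ρ < frontInverse R I₂ φ₂ ρ := by
  have hlt := h₁.strictMonoOn_frontInverse_sub h₂ hg ⟨hρ₁, hρ₂⟩
    ⟨h₁.half_mem_image_frontZone, h₂.half_mem_image_frontZone⟩ hρ
  simpa only [Pi.sub_apply, h₁.frontInverse_half, h₂.frontInverse_half, sub_self,
    sub_neg] using hlt

theorem lt_of_neg (h₁ : DecreasingFront R D f g₁ c I₁ φ₁ p₁)
    (h₂ : DecreasingFront R D f g₂ c I₂ φ₂ p₂) (hg : ∀ ρ ∈ Ioo 0 R, g₂ ρ < g₁ ρ) {ξ : ℝ}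
    (hξ : ξ < 0) (hR : φ₂ ξ < R) : φ₂ ξ < φ₁ ξ := by
  have hhalf := h₂.half_lt_apply_of_neg hξ
  have hzone : ξ ∈ frontZone R I₂ φ₂ := ⟨h₂.Iic_subset hξ.le, h₂.half_mem_Ioo.1.trans hhalf, hR⟩
  have hlt := h₁.frontInverse_lt_of_half_lt h₂ hg ⟨hhalf, hR⟩
  rw [h₂.frontInverse_apply hzone] at hlt
  exact (h₁.lt_frontInverse_iff (h₁.Ico_subset_image_frontZone h₁.half_mem_image_frontZone
    ⟨hhalf.le, hR⟩) (h₁.Iic_subset hξ.le)).1 hlt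

theorem le_of_neg (h₁ : DecreasingFront R D f g₁ c I₁ φ₁ p₁)
    (h₂ : DecreasingFront R D f g₂ c I₂ φ₂ p₂) (hg : ∀ ρ ∈ Ioo 0 R, g₂ ρ < g₁ ρ) {ξ : ℝ}
    (hξ : ξ < 0) : φ₂ ξ ≤ φ₁ ξ := by
  by_contra! hlt
  have hhalf := h₁.half_lt_apply_of_neg hξ
  have hR : φ₁ ξ < R := hlt.trans_le (h₂.mapsTo (h₂.Iic_subset hξ.le)).2
  have hzone : ξ ∈ frontZone R I₁ φ₁ := ⟨h₁.Iic_subset hξ.le, h₁.half_mem_Ioo.1.trans hhalf, hR⟩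
  have hT := h₁.frontInverse_lt_of_half_lt h₂ hg ⟨hhalf, hR⟩
  rw [h₁.frontInverse_apply hzone] at hT
  exact hlt.not_gt ((h₂.frontInverse_lt_iff (h₂.Ico_subset_image_frontZone
    h₂.half_mem_image_frontZone ⟨hhalf.le, hR⟩) (h₂.Iic_subset hξ.le)).1 hT)

theorem lt_of_pos (h₁ : DecreasingFront R D f g₁ c I₁ φ₁ p₁)
    (h₂ : DecreasingFront R D f g₂ c I₂ φ₂ p₂) (hg : ∀ ρ ∈ Ioo 0 R, g₂ ρ < g₁ ρ) {ξ : ℝ}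
    (hξ : 0 < ξ) (hξ₁ : ξ ∈ I₁) (hξ₂ : ξ ∈ I₂) (hpos : 0 < φ₁ ξ) : φ₁ ξ < φ₂ ξ := by
  by_contra! hle
  have hhalf : φ₁ ξ < R / 2 := h₁.apply_zero ▸
    h₁.apply_lt_apply h₁.zero_mem hξ₁ hξ (.inl h₁.zero_mem_frontZone.2)
  have hIoo : φ₁ ξ ∈ Ioo 0 R := ⟨hpos, hhalf.trans h₁.half_mem_Ioo.2⟩
  have hsub : Icc 0 ξ ⊆ I₂ := h₂.ordConnected.out h₂.zero_mem hξ₂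
  obtain ⟨y, hy, hyξ⟩ := intermediate_value_Icc' hξ.le (h₂.continuousOn.mono hsub)
    ⟨hle, h₂.apply_zero.symm ▸ hhalf.le⟩
  have hρ₂ : φ₁ ξ ∈ φ₂ '' frontZone R I₂ φ₂ :=
    ⟨y, ⟨hsub hy, mem_preimage.2 (hyξ.symm ▸ hIoo)⟩, hyξ⟩
  have hlt := h₁.frontInverse_lt_of_lt_half h₂ hg ⟨ξ, ⟨hξ₁, hIoo⟩, rfl⟩ hρ₂ hhalf
  rw [h₁.frontInverse_apply ⟨hξ₁, hIoo⟩, h₂.lt_frontInverse_iff hρ₂ hξ₂] at hlt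
  exact hle.not_gt hlt

end Comparison

end DecreasingFront

section Profiles

variable {R c : ℝ} {D f g φ : ℝ → ℝ}

theorem IsWavefrontProfile.exists_decreasingFront (hφ : IsWavefrontProfile R D f g c R 0 φ)
    (hco : AdmissibleCoefficients R D f g) (hφ0 : φ 0 = R / 2) :
    ∃ p, DecreasingFront R D f g c univ φ p := by
  obtain ⟨p, h⟩ := hφ.travelingWave.exists_hasFlux hφ.classicalOrSharp hco
  have hanti : AntitoneOn φ univ := h.antitoneOn_of_tendsto_atBot univ_mem hφ.tendsto_left
    fun _ hξ => h.le_totalFlux univ_mem ⟨le_rfl, h.range_pos.le⟩ hφ.tendsto_right hξ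
  exact ⟨p, h, subset_univ _, hanti, hφ.tendsto_left, hφ0⟩

theorem IsSemiWavefrontProfileFrom.exists_decreasingFront {w : ℝ}
    (hφ : IsSemiWavefrontProfileFrom R D f g c R w φ) (hco : AdmissibleCoefficients R D f g)
    (hw : 0 < w) (hφ0 : φ 0 = R / 2) : ∃ p, DecreasingFront R D f g c (Iio w) φ p := by
  obtain ⟨p, h⟩ := hφ.travelingWave.exists_hasFlux hφ.classicalOrSharp hco
  have hsub : Iic 0 ⊆ Iio w := Iic_subset_Iio.2 hw
  have hnot : ¬ MonotoneOn φ (Iio w) := fun hmono => by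
    have hle : R ≤ φ 0 := le_of_tendsto hφ.tendsto_left <|
      (eventually_le_atBot 0).mono fun ξ hξ => hmono (hsub hξ) hw hξ
    linarith [h.range_pos]
  exact ⟨p, h, hsub, hφ.monotonic.resolve_left hnot, hφ.tendsto_left, hφ0⟩

end Profiles

theorem mainTheorem8_general {R c : ℝ} {f D : ℝ → ℝ} {g : ℕ → ℝ → ℝ} (hR : 0 < R)
    (hf : DifferentiableOn ℝ f (Icc 0 R)) (hD : ContinuousOn D (Icc 0 R))
    (hDpos : ∀ ρ ∈ Ioo 0 R, 0 < D ρ) (hg0 : ContinuousOn (g 0) (Icc 0 R))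
    (hg0pos : ∀ ρ ∈ Ioo 0 R, 0 < g 0 ρ) (hg : ∀ n, 1 ≤ n → SourcePositive R (g n))
    {φ : ℕ → ℝ → ℝ} {w : ℕ → ℝ} (hφ0 : IsWavefrontProfile R D f (g 0) c R 0 (φ 0))
    (hw : ∀ n, 1 ≤ n → 0 < w n)
    (hφ : ∀ n, 1 ≤ n → IsSemiWavefrontProfileFrom R D f (g n) c R (w n) (φ n))
    (hnorm : ∀ n, φ n 0 = R / 2) :
    (∀ n, 1 ≤ n → (∀ ρ ∈ Ioo 0 R, g 0 ρ < g n ρ) →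
      (∀ ξ < 0, (φ 0 ξ < R → φ 0 ξ < φ n ξ) ∧ (φ 0 ξ = R → φ n ξ = R)) ∧
      (∀ ξ ∈ Ioo 0 (w n), φ n ξ < φ 0 ξ)) ∧
    ((∀ m n, 1 ≤ m → m < n → ∀ ρ ∈ Ioo 0 R, g n ρ < g m ρ) →
      (∀ ξ < 0, ∀ m n, 1 ≤ m → m < n →
        φ n ξ ≤ φ m ξ ∧ (φ n ξ < R → φ n ξ < φ m ξ)) ∧
      (∀ a, (∀ n, 1 ≤ n → a < w n) → ∀ ξ ∈ Icc 0 a, ∀ m n, 1 ≤ m → m < n →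
        φ m ξ ≤ φ n ξ ∧ (0 < ξ → φ m ξ < φ n ξ))) := by
  obtain ⟨p₀, h₀⟩ := hφ0.exists_decreasingFront ⟨hR, hD, hDpos, hf, hg0, hg0pos⟩ (hnorm 0)
  have hfront : ∀ n, 1 ≤ n → ∃ p, DecreasingFront R D f (g n) c (Iio (w n)) (φ n) p := fun n hn =>
    (hφ n hn).exists_decreasingFront ⟨hR, hD, hDpos, hf, (hg n hn).continuousOn,
      fun ρ hρ => (hg n hn).pos ρ (Ioo_subset_Ico_self hρ)⟩ (hw n hn) (hnorm n)
  choose! p h using hfront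
  have hpos : ∀ n, 1 ≤ n → ∀ ξ < w n, 0 < φ n ξ := fun n hn ξ hξ =>
    (h n hn).pos_of_source_zero_pos (h n hn).antitoneOn ((hg n hn).pos 0 ⟨le_rfl, hR⟩) hξ
  refine ⟨fun n hn hlt => ⟨fun ξ hξ => ⟨(h n hn).lt_of_neg h₀ hlt hξ, fun hξR => ?_⟩,
    fun ξ hξ => (h n hn).lt_of_pos h₀ hlt hξ.1 hξ.2 (mem_univ ξ) (hpos n hn ξ hξ.2)⟩,
    fun hlt => ⟨fun ξ hξ m n hm hmn => ?_, fun a ha ξ hξ m n hm hmn => ?_⟩⟩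
  · exact ((h n hn).mapsTo (hξ.trans (hw n hn))).2.antisymm
      (hξR.symm.trans_le ((h n hn).le_of_neg h₀ hlt hξ))
  · have hn := hm.trans hmn.le
    exact ⟨(h m hm).le_of_neg (h n hn) (hlt m n hm hmn) hξ,
      (h m hm).lt_of_neg (h n hn) (hlt m n hm hmn) hξ⟩
  · have hn := hm.trans hmn.le
    have hltφ (hξ0 : 0 < ξ) : φ m ξ < φ n ξ := (h m hm).lt_of_pos (h n hn) (hlt m n hm hmn) hξ0
      (hξ.2.trans_lt (ha m hm)) (hξ.2.trans_lt (ha n hn)) (hpos m hm ξ (hξ.2.trans_lt (ha m hm)))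
    refine ⟨hξ.1.eq_or_lt.elim ?_ fun hξ0 => (hltφ hξ0).le, hltφ⟩
    rintro rfl
    rw [hnorm, hnorm]

theorem mainTheorem8 (R : ℝ) (hR : 0 < R) (f D : ℝ → ℝ) (g : ℕ → ℝ → ℝ) (c : ℝ)
    (hf : ContDiffOn ℝ 1 f (Icc 0 R)) (hf0 : f 0 = 0)
    (hD : DiffusivityHat R D ∨ ∀ n, DiffusivityTilde R D (g n))
    (hg0 : SourceMonostable R D (g 0))
    (hg : ∀ n, 1 ≤ n → SourcePositive R (g n))
    (hdec : ∀ m n, 1 ≤ m → m < n → ∀ ρ ∈ Icc 0 R, g n ρ ≤ g m ρ)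
    (hlim : TendstoUniformlyOn g (g 0) atTop (Icc 0 R))
    (φ : ℕ → ℝ → ℝ) (w : ℕ → ℝ)
    (hφ0 : IsWavefrontProfile R D f (g 0) c R 0 (φ 0))
    (hw : ∀ n, 1 ≤ n → 0 < w n)
    (hφ : ∀ n, 1 ≤ n → IsSemiWavefrontProfileFrom R D f (g n) c R (w n) (φ n))
    (hnorm : ∀ n, φ n 0 = R / 2) :
    (∀ n, 1 ≤ n → (∀ ρ ∈ Ioo 0 R, g 0 ρ < g n ρ) →
      (∀ ξ < 0, (φ 0 ξ < R → φ 0 ξ < φ n ξ) ∧ (φ 0 ξ = R → φ n ξ = R)) ∧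
      (∀ ξ ∈ Ioo 0 (w n), φ n ξ < φ 0 ξ)) ∧
    ((∀ m n, 1 ≤ m → m < n → ∀ ρ ∈ Ioo 0 R, g n ρ < g m ρ) →
      (∀ ξ < 0, ∀ m n, 1 ≤ m → m < n →
        φ n ξ ≤ φ m ξ ∧ (φ n ξ < R → φ n ξ < φ m ξ)) ∧
      (∀ a, (∀ n, 1 ≤ n → a < w n) → ∀ ξ ∈ Icc 0 a, ∀ m n, 1 ≤ m → m < n →
        φ m ξ ≤ φ n ξ ∧ (0 < ξ → φ m ξ < φ n ξ))) :=
  mainTheorem8_general hR (hf.differentiableOn one_ne_zero)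
    (hD.elim (fun h => h.contDiffOn.continuousOn) fun h => (h 0).continuousOn)
    (hD.elim (fun h => h.pos) fun h => (h 0).pos) hg0.continuousOn hg0.pos hg hφ0 hw hφ hnorm
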